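/- Let $G_\bullet$ be a strict Lie $2$-group, i.e. a simplicial Lie group (faces $d_i$, degeneracies $s_i$) whose underlying simplicial manifold is a Lie $1$-groupoid: the horn projections $p_{1,j}:G_1\to G_0$ are surjective submersions and the horn projections $p_{l,j}:G_l\to \mathrm{Hom}(\Lambda[l,j],G_\bullet)$ are diffeomorphisms for all $l\ge 2$, $0\le j\le l$. Equivalently, $G_\bullet$ is the nerve of the Lie groupoid $G_1\rightrightarrows G_0$, and $G_p=G_1\times_{G_0}G_{p-1}$ via $y\mapsto (d_2\cdots d_p\,y,\ d_0y)$; write $y=(a,x)$ if $d_2\cdots d_p\,y=a$ and $d_0y=x$. For a simplicial Lie group $K_\bullet$ let $\mathrm{Dec}\,K$ be its décalage, $\mathrm{Dec}_n K=K_{n+1}$, $d_k^{\mathrm{Dec}}=d_{k+1}$, $s_k^{\mathrm{Dec}}=s_{k+1}$. Let $\overline W_0K=\mathrm{pt}$ and $\overline W_{n+1}K=K_n\times\cdots\times K_0$, with faces $$\bar\partial_0(\gamma^n;\dots;\gamma^0)=(\gamma^{n-1};\dots;\gamma^0),\qquad \bar\partial_{n+1}(\gamma^n;\dots;\gamma^0)=(d_n\gamma^n;\dots;d_1\gamma^1),$$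 $$\bar\partial_i(\gamma^n;\dots;\gamma^0)=(d_{i-1}\gamma^n;\dots;d_1\gamma^{n-i+2};(d_0\gamma^{n-i+1})\gamma^{n-i};\gamma^{n-i-1};\dots;\gamma^0)\quad(0<i\le n),$$ and degeneracies $\bar\sigma_i(\gamma^n;\dots;\gamma^0)=(s_{i-1}\gamma^n;\dots;s_0\gamma^{n+1-i};1;\gamma^{n-i};\dots;\gamma^0)$. Let $W_\bullet K=\mathrm{Dec}(\overline W_\bullet K)$, so that $W_pK=K_p\times\cdots\times K_0$, with faces $\partial_i=\bar\partial_{i+1}$ and degeneracies $\sigma_i=\bar\sigma_{i+1}$. The morphism $d_0:\mathrm{Dec}\,G\to G$ induces $W_\bullet d_0:W_\bullet(\mathrm{Dec}\,G)\to W_\bullet G$, applying $d_0$ to each entry. Then there is exactly one family of maps $\varepsilon_p:W_pG\to W_p(\mathrm{Dec}\,G)$, $p\ge 0$, such that $$\varepsilon_0(g)=s_0(g),\qquad \varepsilon_1(\gamma;g)=\big(s_0\gamma;\ \gamma^{-1}\cdot s_0d_0(\gamma)\cdot s_0(g)\big)$$ (products and inverses in the group $G_1$) and, for $p\ge 2$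 and $\vec\gamma=(\gamma^p;\dots;\gamma^0)\in W_pG$, $$\varepsilon_p(\vec\gamma)=\Big(s_0\gamma^p;\ \big(\bar\partial_0\,\varepsilon_1\,\partial_2\cdots\partial_p(\vec\gamma),\ \gamma^{p-1}\big);\ \bar\partial_0\,\varepsilon_{p-1}\,\partial_0(\vec\gamma)\Big),$$ where $\bar\partial_0$ drops the first entry of a tuple and the second entry is the element of $G_p=G_1\times_{G_0}G_{p-1}$ with the indicated components. In particular the recursion is well defined. The maps $\varepsilon_p$ are smooth and commute with all face and degeneracy maps, i.e. $\varepsilon_\bullet:W_\bullet G\to W_\bullet(\mathrm{Dec}\,G)$ is a map of simplicial manifolds, and it is a section of $W_\bullet d_0$: $W_pd_0\circ\varepsilon_p=\mathrm{id}$ for every $p\ge 0$. -/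

import Mathlib

open scoped Manifold ContDiff

universe u

/-! ### Smooth manifolds and Lie groups (bundled) -/

/-- A smooth finite-dimensional real manifold without boundary, Hausdorff and second countable. -/
structure Mfd : Type (u + 1) where
  carrier : Type u
  E : Type
  H : Type
  [normedAddCommGroup : NormedAddCommGroup E]
  [normedSpace : NormedSpace ℝ E]
  [finiteDimensional : FiniteDimensional ℝ E]
  [topH : TopologicalSpace H]
  I : ModelWithCorners ℝ E H
  [boundaryless : I.Boundaryless]
  [top : TopologicalSpace carrier]
  [t2 : T2Space carrier]
  [secondCountable : SecondCountableTopology carrier]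
  [charted : ChartedSpace H carrier]
  [isManifold : IsManifold I ∞ carrier]

namespace Mfd

instance : CoeSort Mfd.{u} (Type u) := ⟨Mfd.carrier⟩

attribute [instance] normedAddCommGroup normedSpace finiteDimensional topH boundaryless top t2
  secondCountable charted isManifold

/-- The one-point manifold. -/
noncomputable def point : Mfd.{u} where
  carrier := PUnit.{u + 1}
  E := EuclideanSpace ℝ (Fin 0)
  H := EuclideanSpace ℝ (Fin 0)
  I := 𝓡 0
  charted := ChartedSpace.ofDiscreteTopology
  isManifold := IsManifold.of_discreteTopology _

/-- The product manifold. -/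
noncomputable def prod (M N : Mfd.{u}) : Mfd.{u} where
  carrier := M × N
  E := M.E × N.E
  H := ModelProd M.H N.H
  I := M.I.prod N.I

/-- Smoothness of a map between manifolds. -/
def Smooth {M N : Mfd.{u}} (f : M → N) : Prop := ContMDiff M.I N.I ∞ f

end Mfd

/-- A (finite-dimensional real) Lie group. -/
structure LieGrp : Type (u + 1) extends Mfd.{u} where
  [group : Group carrier]
  [lieGroup : LieGroup I ∞ carrier]

namespace LieGrp

instance : CoeSort LieGrp.{u} (Type u) := ⟨fun K => K.carrier⟩

attribute [instance] group lieGroup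

end LieGrp

/-! ### Simplicial manifolds -/

/-- A simplicial manifold: faces `d` and degeneracies `s`, smooth, with the simplicial
identities. -/
structure SimplicialMfd : Type (u + 1) where
  X : ℕ → Mfd.{u}
  d : ∀ {n : ℕ}, Fin (n + 2) → X (n + 1) → X n
  s : ∀ {n : ℕ}, Fin (n + 1) → X n → X (n + 1)
  smooth_d : ∀ {n : ℕ} (i : Fin (n + 2)), Mfd.Smooth (d i)
  smooth_s : ∀ {n : ℕ} (i : Fin (n + 1)), Mfd.Smooth (s i)
  d_d : ∀ {n : ℕ} (i j : Fin (n + 2)), i ≤ j → ∀ x : X (n + 2),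
    d i (d j.succ x) = d j (d i.castSucc x)
  s_s : ∀ {n : ℕ} (i j : Fin (n + 1)), i ≤ j → ∀ x : X n,
    s i.castSucc (s j x) = s j.succ (s i x)
  d_s_of_le : ∀ {n : ℕ} (i : Fin (n + 2)) (j : Fin (n + 1)), i ≤ j.castSucc →
    ∀ x : X (n + 1), d i.castSucc (s j.succ x) = s j (d i x)
  d_s_self : ∀ {n : ℕ} (i : Fin (n + 1)) (x : X n), d i.castSucc (s i x) = x
  d_s_succ : ∀ {n : ℕ} (i : Fin (n + 1)) (x : X n), d i.succ (s i x) = x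
  d_s_of_gt : ∀ {n : ℕ} (i : Fin (n + 2)) (j : Fin (n + 1)), j.castSucc < i →
    ∀ x : X (n + 1), d i.succ (s j.castSucc x) = s j (d i x)

namespace SimplicialMfd

/-- A simplicial map: smooth maps commuting with all faces and degeneracies. -/
structure Hom (X Y : SimplicialMfd.{u}) : Type u where
  app : ∀ n : ℕ, X.X n → Y.X n
  smooth : ∀ n : ℕ, Mfd.Smooth (app n)
  comm_d : ∀ {n : ℕ} (i : Fin (n + 2)) (x : X.X (n + 1)),
    app n (X.d i x) = Y.d i (app (n + 1) x)
  comm_s : ∀ {n : ℕ} (i : Fin (n + 1)) (x : X.X n),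
    app (n + 1) (X.s i x) = Y.s i (app n x)

/-- The décalage: `dec X` in degree `n` is `X` in degree `n + 1`, with the zeroth face and the
zeroth degeneracy forgotten. -/
def dec (X : SimplicialMfd.{u}) : SimplicialMfd.{u} where
  X n := X.X (n + 1)
  d k := X.d k.succ
  s k := X.s k.succ
  smooth_d k := X.smooth_d k.succ
  smooth_s k := X.smooth_s k.succ
  d_d i j h x := X.d_d i.succ j.succ (Fin.succ_le_succ_iff.2 h) x
  s_s i j h x := X.s_s i.succ j.succ (Fin.succ_le_succ_iff.2 h) x
  d_s_of_le i j h x := X.d_s_of_le i.succ j.succ (Fin.succ_le_succ_iff.2 h) x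
  d_s_self i x := X.d_s_self i.succ x
  d_s_succ i x := X.d_s_succ i.succ x
  d_s_of_gt i j h x := X.d_s_of_gt i.succ j.succ (Fin.succ_lt_succ_iff.2 h) x

/-- Functoriality of the décalage. -/
def decMap {X Y : SimplicialMfd.{u}} (f : Hom X Y) : Hom X.dec Y.dec where
  app n := f.app (n + 1)
  smooth n := f.smooth (n + 1)
  comm_d i x := f.comm_d i.succ x
  comm_s i x := f.comm_s i.succ x

/-- The iterated last face `d₂ ∘ d₃ ∘ ⋯ ∘ dₙ₊₁ : Xₙ₊₁ → X₁`, i.e. the edge joining the vertices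
`0` and `1` (the identity for `n = 0`). -/
def front (X : SimplicialMfd.{u}) : ∀ n : ℕ, X.X (n + 1) → X.X 1
  | 0, x => x
  | n + 1, x => X.front n (X.d (Fin.last (n + 2)) x)

/-- The horn projection `p_{l,j} : X_l → Hom(Λ[l,j], X)`, `l = n + 2`, as a map into the product
of copies of `X_{l-1}` indexed by the faces of the horn. -/
def hornProj (X : SimplicialMfd.{u}) (n : ℕ) (j : Fin (n + 3)) (x : X.X (n + 2)) :
    {i : Fin (n + 3) // i ≠ j} → X.X (n + 1) :=
  fun i => X.d i.1 x

/-- The space of horns `Hom(Λ[l,j], X)`, `l = n + 2`: the families `(y_i)_{i ≠ j}` of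
`(l-1)`-simplices with `d_i y_{k+1} = d_k y_i` for `i ≤ k`, `i ≠ j`, `k + 1 ≠ j`. -/
def horns (X : SimplicialMfd.{u}) (n : ℕ) (j : Fin (n + 3)) :
    Set ({i : Fin (n + 3) // i ≠ j} → X.X (n + 1)) :=
  {y | ∀ (i k : Fin (n + 2)) (hi : i.castSucc ≠ j) (hk : k.succ ≠ j), i ≤ k →
    X.d i (y ⟨k.succ, hk⟩) = X.d k (y ⟨i.castSucc, hi⟩)}

/-- A Lie `1`-groupoid (the nerve of a Lie groupoid `X₁ ⇉ X₀`): the horn projections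
`p_{1,j} : X₁ → X₀` are surjective submersions, and for all `l ≥ 2` and `0 ≤ j ≤ l` the horn
projection `p_{l,j}` is a diffeomorphism onto `Hom(Λ[l,j], X)`, that is, a smooth embedding
into the product of the faces with image the set of all horns. -/
structure IsLieGroupoid (X : SimplicialMfd.{u}) : Prop where
  surjective : ∀ i : Fin 2, Function.Surjective (X.d i : X.X 1 → X.X 0)
  submersion : ∀ i : Fin 2,
    Manifold.IsSubmersion (X.X 1).I (X.X 0).I ∞ (X.d i : X.X 1 → X.X 0)
  embedding : ∀ (n : ℕ) (j : Fin (n + 3)),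
    Manifold.IsSmoothEmbedding (X.X (n + 2)).I
      (ModelWithCorners.pi fun _ : {i : Fin (n + 3) // i ≠ j} => (X.X (n + 1)).I) ∞
      (X.hornProj n j)
  range : ∀ (n : ℕ) (j : Fin (n + 3)), Set.range (X.hornProj n j) = X.horns n j

end SimplicialMfd

/-! ### Simplicial Lie groups -/

/-- A simplicial Lie group: faces and degeneracies are smooth group homomorphisms satisfying
the simplicial identities. -/
structure SimplicialLieGrp : Type (u + 1) where
  X : ℕ → LieGrp.{u}
  d : ∀ {n : ℕ}, Fin (n + 2) → (X (n + 1) →* X n)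
  s : ∀ {n : ℕ}, Fin (n + 1) → (X n →* X (n + 1))
  smooth_d : ∀ {n : ℕ} (i : Fin (n + 2)),
    Mfd.Smooth (M := (X (n + 1)).toMfd) (N := (X n).toMfd) (d i)
  smooth_s : ∀ {n : ℕ} (i : Fin (n + 1)),
    Mfd.Smooth (M := (X n).toMfd) (N := (X (n + 1)).toMfd) (s i)
  d_d : ∀ {n : ℕ} (i j : Fin (n + 2)), i ≤ j → ∀ x : X (n + 2),
    d i (d j.succ x) = d j (d i.castSucc x)
  s_s : ∀ {n : ℕ} (i j : Fin (n + 1)), i ≤ j → ∀ x : X n,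
    s i.castSucc (s j x) = s j.succ (s i x)
  d_s_of_le : ∀ {n : ℕ} (i : Fin (n + 2)) (j : Fin (n + 1)), i ≤ j.castSucc →
    ∀ x : X (n + 1), d i.castSucc (s j.succ x) = s j (d i x)
  d_s_self : ∀ {n : ℕ} (i : Fin (n + 1)) (x : X n), d i.castSucc (s i x) = x
  d_s_succ : ∀ {n : ℕ} (i : Fin (n + 1)) (x : X n), d i.succ (s i x) = x
  d_s_of_gt : ∀ {n : ℕ} (i : Fin (n + 2)) (j : Fin (n + 1)), j.castSucc < i →
    ∀ x : X (n + 1), d i.succ (s j.castSucc x) = s j (d i x)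

namespace SimplicialLieGrp

/-- The underlying simplicial manifold. -/
def toSimplicialMfd (K : SimplicialLieGrp.{u}) : SimplicialMfd.{u} where
  X n := (K.X n).toMfd
  d i := K.d i
  s i := K.s i
  smooth_d := K.smooth_d
  smooth_s := K.smooth_s
  d_d := K.d_d
  s_s := K.s_s
  d_s_of_le := K.d_s_of_le
  d_s_self := K.d_s_self
  d_s_succ := K.d_s_succ
  d_s_of_gt := K.d_s_of_gt

/-- A strict Lie `2`-group: a simplicial Lie group whose underlying simplicial manifold is a
Lie `1`-groupoid. -/
def IsStrictLieTwoGroup (G : SimplicialLieGrp.{u}) : Prop :=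
  G.toSimplicialMfd.IsLieGroupoid

/-- A morphism of simplicial Lie groups. -/
structure Hom (K L : SimplicialLieGrp.{u}) : Type u where
  app : ∀ n : ℕ, K.X n →* L.X n
  smooth : ∀ n : ℕ, Mfd.Smooth (M := (K.X n).toMfd) (N := (L.X n).toMfd) (app n)
  comm_d : ∀ {n : ℕ} (i : Fin (n + 2)) (x : K.X (n + 1)),
    app n (K.d i x) = L.d i (app (n + 1) x)
  comm_s : ∀ {n : ℕ} (i : Fin (n + 1)) (x : K.X n),
    app (n + 1) (K.s i x) = L.s i (app n x)

/-- The décalage of a simplicial Lie group. -/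
def dec (K : SimplicialLieGrp.{u}) : SimplicialLieGrp.{u} where
  X n := K.X (n + 1)
  d k := K.d k.succ
  s k := K.s k.succ
  smooth_d k := K.smooth_d k.succ
  smooth_s k := K.smooth_s k.succ
  d_d i j h x := K.d_d i.succ j.succ (Fin.succ_le_succ_iff.2 h) x
  s_s i j h x := K.s_s i.succ j.succ (Fin.succ_le_succ_iff.2 h) x
  d_s_of_le i j h x := K.d_s_of_le i.succ j.succ (Fin.succ_le_succ_iff.2 h) x
  d_s_self i x := K.d_s_self i.succ x
  d_s_succ i x := K.d_s_succ i.succ x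
  d_s_of_gt i j h x := K.d_s_of_gt i.succ j.succ (Fin.succ_lt_succ_iff.2 h) x

/-- The morphism `d₀ : dec K → K`. -/
def decD0 (K : SimplicialLieGrp.{u}) : Hom K.dec K where
  app _ := K.d 0
  smooth _ := K.smooth_d 0
  comm_d i x := K.d_d 0 i (Fin.zero_le i) x
  comm_s i x := K.d_s_of_le 0 i (Fin.zero_le _) x

/-! ### The functors `W̄` and `W` -/

/-- The manifold `W̄₀ K = pt`, `W̄ₙ₊₁ K = Kₙ × Kₙ₋₁ × ⋯ × K₀`, as iterated pairs
`(γⁿ, (γⁿ⁻¹, …, (γ⁰, pt)))`. -/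
noncomputable def WbarObj (K : SimplicialLieGrp.{u}) : ℕ → Mfd.{u}
  | 0 => Mfd.point
  | n + 1 => (K.X n).toMfd.prod (K.WbarObj n)

/-- The faces of `W̄ K`:
`∂̄₀ (γⁿ; …; γ⁰) = (γⁿ⁻¹; …; γ⁰)`,
`∂̄ᵢ (γⁿ; …; γ⁰) = (dᵢ₋₁ γⁿ; …; d₁ γⁿ⁻ⁱ⁺²; (d₀ γⁿ⁻ⁱ⁺¹) γⁿ⁻ⁱ; γⁿ⁻ⁱ⁻¹; …; γ⁰)` for `0 < i ≤ n`,
`∂̄ₙ₊₁ (γⁿ; …; γ⁰) = (dₙ γⁿ; …; d₁ γ¹)`. -/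
noncomputable def WbarD (K : SimplicialLieGrp.{u}) :
    ∀ n : ℕ, Fin (n + 2) → K.WbarObj (n + 1) → K.WbarObj n
  | 0, _, _ => PUnit.unit
  | n + 1, i, x =>
    Fin.cases (motive := fun _ => K.X n × K.WbarObj n)
      x.2
      (fun k : Fin (n + 2) => Fin.cases (motive := fun _ => K.X n × K.WbarObj n)
        (K.d 0 x.1 * x.2.1, x.2.2)
        (fun l : Fin (n + 1) => (K.d l.succ x.1, K.WbarD n l.succ x.2)) k) i

/-- The degeneracies of `W̄ K`:
`σ̄ᵢ (γⁿ; …; γ⁰) = (sᵢ₋₁ γⁿ; …; s₀ γⁿ⁺¹⁻ⁱ; 1; γⁿ⁻ⁱ; …; γ⁰)`. -/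
noncomputable def WbarS (K : SimplicialLieGrp.{u}) :
    ∀ n : ℕ, Fin (n + 1) → K.WbarObj n → K.WbarObj (n + 1)
  | 0, _, x => ((1 : K.X 0), x)
  | n + 1, i, x =>
    Fin.cases (motive := fun _ => K.X (n + 1) × K.WbarObj (n + 1))
      (1, x)
      (fun k : Fin (n + 1) => (K.s k x.1, K.WbarS n k x.2)) i

section WbarLemmas

variable (K : SimplicialLieGrp.{u})

theorem WbarD_zero {n : ℕ} (x : K.WbarObj (n + 1)) : K.WbarD n 0 x = x.2 := by
  cases n <;> rfl

theorem WbarD_one {n : ℕ} (x : K.WbarObj (n + 2)) :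
    K.WbarD (n + 1) 1 x = ((K.d 0 x.1 * x.2.1, x.2.2) : K.X n × K.WbarObj n) := rfl

theorem WbarD_succ_succ {n : ℕ} (l : Fin (n + 1)) (x : K.WbarObj (n + 2)) :
    K.WbarD (n + 1) l.succ.succ x
      = ((K.d l.succ x.1, K.WbarD n l.succ x.2) : K.X n × K.WbarObj n) := rfl

theorem WbarS_zero {n : ℕ} (x : K.WbarObj n) :
    K.WbarS n 0 x = ((1, x) : K.X n × K.WbarObj n) := by
  cases n <;> rfl

theorem WbarS_succ {n : ℕ} (k : Fin (n + 1)) (x : K.WbarObj (n + 1)) :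
    K.WbarS (n + 1) k.succ x
      = ((K.s k x.1, K.WbarS n k x.2) : K.X (n + 1) × K.WbarObj (n + 1)) := rfl

theorem WbarD_smooth : ∀ (n : ℕ) (i : Fin (n + 2)), Mfd.Smooth (K.WbarD n i)
  | 0, _ => contMDiff_const
  | n + 1, i => by
    have h1 : ContMDiff ((K.X (n + 1)).I.prod ((K.X n).I.prod (K.WbarObj n).I))
        (K.X (n + 1)).I ∞
        (fun x : K.X (n + 1) × (K.X n × K.WbarObj n) => x.1) := contMDiff_fst
    have h2 : ContMDiff ((K.X (n + 1)).I.prod ((K.X n).I.prod (K.WbarObj n).I))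
        ((K.X n).I.prod (K.WbarObj n).I) ∞
        (fun x : K.X (n + 1) × (K.X n × K.WbarObj n) => x.2) := contMDiff_snd
    refine Fin.cases ?_ (fun k => Fin.cases ?_ (fun l => ?_) k) i
    · exact h2
    · exact (((K.smooth_d 0).comp h1).mul (contMDiff_fst.comp h2)).prodMk
        (contMDiff_snd.comp h2)
    · exact ((K.smooth_d l.succ).comp h1).prodMk ((WbarD_smooth n l.succ).comp h2)

theorem WbarS_smooth : ∀ (n : ℕ) (i : Fin (n + 1)), Mfd.Smooth (K.WbarS n i)
  | 0, _ => by
    have h : ContMDiff (K.WbarObj 0).I ((K.X 0).I.prod (K.WbarObj 0).I) ∞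
        (fun x : K.WbarObj 0 => ((1 : K.X 0), x)) := contMDiff_const.prodMk contMDiff_id
    exact h
  | n + 1, i => by
    have h1 : ContMDiff ((K.X n).I.prod (K.WbarObj n).I) (K.X n).I ∞
        (fun x : K.X n × K.WbarObj n => x.1) := contMDiff_fst
    have h2 : ContMDiff ((K.X n).I.prod (K.WbarObj n).I) (K.WbarObj n).I ∞
        (fun x : K.X n × K.WbarObj n => x.2) := contMDiff_snd
    refine Fin.cases ?_ (fun k => ?_) i
    · have h : ContMDiff ((K.X n).I.prod (K.WbarObj n).I)
          ((K.X (n + 1)).I.prod ((K.X n).I.prod (K.WbarObj n).I)) ∞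
          (fun x : K.X n × K.WbarObj n => ((1 : K.X (n + 1)), x)) :=
        contMDiff_const.prodMk contMDiff_id
      exact h
    · exact ((K.smooth_s k).comp h1).prodMk ((WbarS_smooth n k).comp h2)

theorem WbarD_WbarD : ∀ (n : ℕ) (i j : Fin (n + 2)), i ≤ j → ∀ x : K.WbarObj (n + 2),
    K.WbarD n i (K.WbarD (n + 1) j.succ x) = K.WbarD n j (K.WbarD (n + 1) i.castSucc x)
  | 0, _, _, _, _ => rfl
  | n + 1, i, j, h, x => by
    obtain ⟨a, b, c, w⟩ := x
    induction i using Fin.cases with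
    | zero =>
      induction j using Fin.cases with
      | zero => rfl
      | succ j => rfl
    | succ i =>
      induction j using Fin.cases with
      | zero => simp at h
      | succ j =>
        have h' : i ≤ j := Fin.succ_le_succ_iff.1 h
        induction i using Fin.cases with
        | zero =>
          induction j using Fin.cases with
          | zero =>
            change ((K.d 0 (K.d 1 a) * (K.d 0 b * c), w) : K.X n × K.WbarObj n)
              = (K.d 0 (K.d 0 a * b) * c, w)
            rw [map_mul, mul_assoc]
            exact congrArg (fun t => ((t * (K.d 0 b * c), w) : K.X n × K.WbarObj n))
              (K.d_d 0 0 le_rfl a)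
          | succ j =>
            change ((K.d 0 (K.d j.succ.succ a) * K.d j.succ b, K.WbarD n j.succ (c, w)) :
                K.X n × K.WbarObj n)
              = (K.d j.succ (K.d 0 a * b), K.WbarD n j.succ (c, w))
            rw [map_mul]
            exact congrArg
              (fun t => ((t * K.d j.succ b, K.WbarD n j.succ (c, w)) : K.X n × K.WbarObj n))
              (K.d_d 0 j.succ (Fin.zero_le _) a)
        | succ i =>
          induction j using Fin.cases with
          | zero => simp at h'
          | succ j =>
            exact Prod.ext (K.d_d i.succ j.succ h' a)
              (WbarD_WbarD n i.succ j.succ h' (b, (c, w)))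

theorem WbarS_WbarS : ∀ (n : ℕ) (i j : Fin (n + 1)), i ≤ j → ∀ x : K.WbarObj n,
    K.WbarS (n + 1) i.castSucc (K.WbarS n j x) = K.WbarS (n + 1) j.succ (K.WbarS n i x)
  | 0, i, j, _, x => by
    obtain rfl : i = 0 := Fin.fin_one_eq_zero _
    obtain rfl : j = 0 := Fin.fin_one_eq_zero _
    exact Prod.ext (map_one (K.s 0)).symm rfl
  | n + 1, i, j, h, x => by
    induction i using Fin.cases with
    | zero => exact Prod.ext (map_one (K.s j)).symm rfl
    | succ i =>
      induction j using Fin.cases with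
      | zero => simp at h
      | succ j =>
        have h' : i ≤ j := Fin.succ_le_succ_iff.1 h
        exact Prod.ext (K.s_s i j h' x.1) (WbarS_WbarS n i j h' x.2)

theorem WbarD_WbarS_of_le : ∀ (n : ℕ) (i : Fin (n + 2)) (j : Fin (n + 1)),
    i ≤ j.castSucc → ∀ x : K.WbarObj (n + 1),
    K.WbarD (n + 1) i.castSucc (K.WbarS (n + 1) j.succ x) = K.WbarS n j (K.WbarD n i x)
  | 0, i, j, h, x => by
    obtain rfl : j = 0 := Fin.fin_one_eq_zero _
    obtain rfl : i = 0 := Fin.le_zero_iff.1 h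
    rfl
  | n + 1, i, j, h, x => by
    induction i using Fin.cases with
    | zero => rfl
    | succ i =>
      induction j using Fin.cases with
      | zero => simp at h
      | succ j =>
        have h' : i ≤ j.castSucc := Fin.succ_le_succ_iff.1 h
        induction i using Fin.cases with
        | zero =>
          refine Prod.ext ?_ rfl
          change K.d 0 (K.s j.succ x.1) * K.s j x.2.1 = K.s j (K.d 0 x.1 * x.2.1)
          rw [map_mul]
          exact congrArg (· * K.s j x.2.1) (K.d_s_of_le 0 j (Fin.zero_le _) x.1)
        | succ i =>
          exact Prod.ext (K.d_s_of_le i.succ j h' x.1)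
            (WbarD_WbarS_of_le n i.succ j h' x.2)

theorem WbarD_WbarS_self : ∀ (n : ℕ) (i : Fin (n + 1)) (x : K.WbarObj n),
    K.WbarD n i.castSucc (K.WbarS n i x) = x
  | 0, _, _ => rfl
  | n + 1, i, x => by
    induction i using Fin.cases with
    | zero => rfl
    | succ i =>
      cases n with
      | zero =>
        obtain rfl : i = 0 := Fin.fin_one_eq_zero _
        refine Prod.ext ?_ rfl
        change K.d 0 (K.s 0 x.1) * 1 = x.1
        rw [mul_one]
        exact K.d_s_self 0 x.1
      | succ n =>
        induction i using Fin.cases with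
        | zero =>
          refine Prod.ext ?_ rfl
          change K.d 0 (K.s 0 x.1) * 1 = x.1
          rw [mul_one]
          exact K.d_s_self 0 x.1
        | succ i =>
          exact Prod.ext (K.d_s_self i.succ x.1) (WbarD_WbarS_self (n + 1) i.succ x.2)

theorem WbarD_WbarS_succ : ∀ (n : ℕ) (i : Fin (n + 1)) (x : K.WbarObj n),
    K.WbarD n i.succ (K.WbarS n i x) = x
  | 0, _, _ => rfl
  | n + 1, i, x => by
    induction i using Fin.cases with
    | zero =>
      refine Prod.ext ?_ rfl
      change K.d 0 1 * x.1 = x.1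
      rw [map_one, one_mul]
    | succ i =>
      exact Prod.ext (K.d_s_succ i x.1) (WbarD_WbarS_succ n i x.2)

theorem WbarD_WbarS_of_gt : ∀ (n : ℕ) (i : Fin (n + 2)) (j : Fin (n + 1)),
    j.castSucc < i → ∀ x : K.WbarObj (n + 1),
    K.WbarD (n + 1) i.succ (K.WbarS (n + 1) j.castSucc x) = K.WbarS n j (K.WbarD n i x)
  | 0, i, j, h, x => by
    obtain rfl : j = 0 := Fin.fin_one_eq_zero _
    obtain rfl : i = 1 := by
      have : (0 : ℕ) < i.1 := h
      apply Fin.ext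
      have := i.2
      simp
      omega
    exact Prod.ext (map_one (K.d 1)) rfl
  | n + 1, i, j, h, x => by
    induction i using Fin.cases with
    | zero => simp at h
    | succ i =>
      induction j using Fin.cases with
      | zero => exact Prod.ext (map_one (K.d i.succ)) rfl
      | succ j =>
        have h' : j.castSucc < i := Fin.succ_lt_succ_iff.1 h
        induction i using Fin.cases with
        | zero => simp at h'
        | succ i =>
          exact Prod.ext (K.d_s_of_gt i.succ j h' x.1)
            (WbarD_WbarS_of_gt n i.succ j h' x.2)

end WbarLemmas

/-- The simplicial manifold `W̄ K`. -/
noncomputable def Wbar (K : SimplicialLieGrp.{u}) : SimplicialMfd.{u} where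
  X := K.WbarObj
  d {n} := K.WbarD n
  s {n} := K.WbarS n
  smooth_d {n} := K.WbarD_smooth n
  smooth_s {n} := K.WbarS_smooth n
  d_d {n} := K.WbarD_WbarD n
  s_s {n} := K.WbarS_WbarS n
  d_s_of_le {n} := K.WbarD_WbarS_of_le n
  d_s_self {n} := K.WbarD_WbarS_self n
  d_s_succ {n} := K.WbarD_WbarS_succ n
  d_s_of_gt {n} := K.WbarD_WbarS_of_gt n

/-- `W K = dec (W̄ K)`, with `W_p K = K_p × K_{p-1} × ⋯ × K_0`. -/
noncomputable def W (K : SimplicialLieGrp.{u}) : SimplicialMfd.{u} := K.Wbar.dec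

/-- `W̄ f`, degreewise: `(γⁿ; …; γ⁰) ↦ (f γⁿ; …; f γ⁰)`. -/
def WbarMapApp {K L : SimplicialLieGrp.{u}} (f : Hom K L) :
    ∀ n : ℕ, K.WbarObj n → L.WbarObj n
  | 0, x => x
  | n + 1, x => (f.app n x.1, WbarMapApp f n x.2)

/-- Functoriality of `W̄`. -/
noncomputable def WbarMap {K L : SimplicialLieGrp.{u}} (f : Hom K L) :
    SimplicialMfd.Hom K.Wbar L.Wbar where
  app := WbarMapApp f
  smooth := by
    intro n
    induction n with
    | zero => exact contMDiff_id
    | succ n ih =>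
      have h1 : ContMDiff ((K.X n).I.prod (K.WbarObj n).I) (K.X n).I ∞
          (fun x : K.X n × K.WbarObj n => x.1) := contMDiff_fst
      have h2 : ContMDiff ((K.X n).I.prod (K.WbarObj n).I) (K.WbarObj n).I ∞
          (fun x : K.X n × K.WbarObj n => x.2) := contMDiff_snd
      have h3 : ContMDiff (K.WbarObj n).I (L.WbarObj n).I ∞ (WbarMapApp f n) := ih
      exact ((f.smooth n).comp h1).prodMk (h3.comp h2)
  comm_d := by
    intro n
    induction n with
    | zero => intro i x; rfl
    | succ n ih =>
      intro i x
      induction i using Fin.cases with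
      | zero => rfl
      | succ k =>
        induction k using Fin.cases with
        | zero =>
          refine Prod.ext ?_ rfl
          change f.app n (K.d 0 x.1 * x.2.1) = L.d 0 (f.app (n + 1) x.1) * f.app n x.2.1
          rw [map_mul, f.comm_d]
        | succ l => exact Prod.ext (f.comm_d l.succ x.1) (ih l.succ x.2)
  comm_s := by
    intro n
    induction n with
    | zero => intro i x; exact Prod.ext (map_one (f.app 0)) rfl
    | succ n ih =>
      intro i x
      induction i using Fin.cases with
      | zero => exact Prod.ext (map_one (f.app (n + 1))) rfl
      | succ k => exact Prod.ext (f.comm_s k x.1) (ih k x.2)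

/-- Functoriality of `W`. -/
noncomputable def WMap {K L : SimplicialLieGrp.{u}} (f : Hom K L) :
    SimplicialMfd.Hom K.W L.W :=
  SimplicialMfd.decMap (WbarMap f)

/-! ### The recursion defining the maps `ε_p` -/

/-- `y = (a, x)` under the identification `G_{n+1} = G₁ ×_{G₀} G_n` of the nerve of the groupoid
`G₁ ⇉ G₀`: the first arrow of the string `y` (the edge joining the vertices `0` and `1`) is `a`,
and the remaining string `d₀ y` is `x`. -/
def IsJoin (G : SimplicialLieGrp.{u}) {n : ℕ} (a : G.X 1) (x : G.X n) (y : G.X (n + 1)) : Prop :=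
  G.toSimplicialMfd.front n y = a ∧ G.d 0 y = x

/-- The family of maps `ε_p : W_p G → W_p (dec G)` satisfies
`ε₀ (g) = s₀ g`, `ε₁ (γ; g) = (s₀ γ; γ⁻¹ · s₀ d₀ γ · s₀ g)` and, for `p ≥ 2` and
`w = (γᵖ; γᵖ⁻¹; …; γ⁰)`,
`ε_p (w) = (s₀ γᵖ; (∂̄₀ ε₁ ∂₂ ⋯ ∂_p w, γᵖ⁻¹); ∂̄₀ ε_{p-1} ∂₀ w)`, where the second entry is the
element of `G_p = G₁ ×_{G₀} G_{p-1}` with the given components. -/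
structure IsTwistedDegeneracy (G : SimplicialLieGrp.{u})
    (ε : ∀ p : ℕ, G.W.X p → G.dec.W.X p) : Prop where
  zero : ∀ g : G.X 0, ε 0 (g, PUnit.unit) = (G.s 0 g, PUnit.unit)
  one : ∀ (γ : G.X 1) (g : G.X 0),
    ε 1 (γ, g, PUnit.unit) = (G.s 0 γ, γ⁻¹ * G.s 0 (G.d 0 γ) * G.s 0 g, PUnit.unit)
  step : ∀ (p : ℕ) (w : G.W.X (p + 2)), ∃ y : G.X (p + 2),
    G.IsJoin (ε 1 (G.W.front (p + 1) w)).2.1 w.2.1 y ∧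
    ε (p + 2) w = (G.s 0 w.1, y, (ε (p + 1) (G.W.d 0 w)).2)

end SimplicialLieGrp

/-! The recursion has a closed solution. Put `c_p = γᵖ` and `c_k = d₀ c_{k+1} · γᵏ`. These are the
leading entries of `w, ∂₀ w, ∂₀² w, …`. Then `ε_p (w) = (s₀ γᵖ; c_p⁻¹ · s₀ d₀ c_p · s₀ γᵖ⁻¹; …; c₁⁻¹
· s₀ d₀ c₁ · s₀ γ⁰)`.

For this formula everything except uniqueness follows from the simplicial identities and the group
laws. Smoothness is clear, and `d₀` of the entry `c⁻¹ · s₀ d₀ c · s₀ γ` is `γ`, so `ε` is a section.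
A face of `W (Dec G)` either acts on the entries separately, which `d_succ_succ_twist` handles, or
multiplies two neighbours, and then the factors `c⁻¹` telescope. A degeneracy inserts a `1`, matched
by `twist_s_zero_one`.

The recursion follows from simpliciality: `ε₁ ∂₂ ⋯ ∂_p = ∂₂ ⋯ ∂_p ε_p`, and the second entry of the
right side is the front edge of the second entry of `ε_p (w)`.

The groupoid hypothesis enters only in uniqueness: by `IsLieGroupoid.ext_front` an element with
prescribed front edge and zeroth face is unique, so the recursion leaves no choice. -/

/-! ### Front edges and initial vertices -/

namespace SimplicialMfd

/-- The initial vertex `d₁ ⋯ dₙ x` of a simplex `x : Xₙ`. -/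
def initialVertex (X : SimplicialMfd.{u}) : ∀ n : ℕ, X.X n → X.X 0
  | 0, x => x
  | n + 1, x => X.initialVertex n (X.d (Fin.last (n + 1)) x)

/-- The décalage shifts `d₁ ⋯ dₙ` to `d₂ ⋯ dₙ₊₁`. This turns the vertex found by `W_front_snd_fst`
in `W (Dec G)` into the front edge required by `IsJoin`. -/
theorem dec_initialVertex (X : SimplicialMfd.{u}) :
    ∀ (n : ℕ) (x : X.X (n + 1)), X.dec.initialVertex n x = X.front n x
  | 0, _ => rfl
  | n + 1, x => X.dec_initialVertex n (X.d (Fin.last (n + 2)) x)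

theorem Hom.comm_front {X Y : SimplicialMfd.{u}} (f : Hom X Y) :
    ∀ (n : ℕ) (x : X.X (n + 1)), f.app 1 (X.front n x) = Y.front n (f.app (n + 1) x)
  | 0, _ => rfl
  | n + 1, x => by
    change f.app 1 (X.front n _) = Y.front n _
    rw [f.comm_front n, f.comm_d]

/-- A face opposite to a vertex other than `0` and `1` does not change the front edge. -/
theorem front_d (X : SimplicialMfd.{u}) : ∀ (n : ℕ) (i : Fin (n + 1)) (x : X.X (n + 2)),
    X.front n (X.d i.succ.succ x) = X.front (n + 1) x
  | 0, i, x => by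
    obtain rfl : i = 0 := Fin.fin_one_eq_zero _
    rfl
  | n + 1, i, x => by
    induction i using Fin.lastCases with
    | last => rfl
    | cast i =>
      have h := X.d_d i.succ.succ (Fin.last (n + 2)) (Fin.le_last _) x
      change X.front n (X.d (Fin.last (n + 2)) (X.d i.succ.succ.castSucc x))
        = X.front (n + 1) (X.d (Fin.last (n + 2)).succ x)
      rw [← h, X.front_d n i]

/-- In the nerve of a groupoid, a simplex is determined by its front edge and its zeroth face. -/
theorem IsLieGroupoid.ext_front {X : SimplicialMfd.{u}} (hX : X.IsLieGroupoid) :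
    ∀ (n : ℕ) (x y : X.X (n + 1)), X.front n x = X.front n y → X.d 0 x = X.d 0 y → x = y
  | 0, _, _, h, _ => h
  | n + 1, x, y, hf, h0 => by
    -- The horn `Λ[n+2,1]` omits exactly the face that changes the front edge without being the
    -- given `d₀`. The faces `dᵢ` with `i ≥ 2` keep the front edge and satisfy `d₀ dᵢ = dᵢ₋₁ d₀`, so
    -- induction applies to them.
    refine (hX.embedding n 1).isEmbedding.injective (funext fun ⟨i, hi⟩ => ?_)
    change X.d i x = X.d i y
    induction i using Fin.cases with
    | zero => exact h0
    | succ i =>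
      induction i using Fin.cases with
      | zero => exact absurd rfl hi
      | succ i =>
        refine hX.ext_front n _ _ ?_ ?_
        · rw [X.front_d, X.front_d, hf]
        · have h := X.d_d 0 i.succ (Fin.zero_le _)
          exact (h x).trans ((congrArg _ h0).trans (h y).symm)

end SimplicialMfd

namespace SimplicialLieGrp

/-- Each last face of `W K` acts on the second entry by its own last face, without any
multiplication. -/
theorem W_front_snd_fst (K : SimplicialLieGrp.{u}) : ∀ (n : ℕ) (w : K.W.X (n + 1)),
    (K.W.front n w).2.1 = K.toSimplicialMfd.initialVertex n w.2.1
  | 0, _ => rfl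
  | n + 1, w => K.W_front_snd_fst n (K.W.d (Fin.last (n + 2)) w)

/-! ### Faces and degeneracies of a single twisted entry -/

variable (G : SimplicialLieGrp.{u})

/-- The element `c⁻¹ · s₀ d₀ c · s₀ γ`: the front edge is `a⁻¹ · s₀ d₀ a · s₀ v`, with `a` the front
edge of `c` and `v` the initial vertex of `γ`, and the zeroth face is `γ`. -/
def twist {n : ℕ} (c : G.X (n + 1)) (γ : G.X n) : G.X (n + 1) :=
  c⁻¹ * G.s 0 (G.d 0 c) * G.s 0 γ

variable {G}

theorem d_zero_s_zero {n : ℕ} (x : G.X n) : G.d 0 (G.s 0 x) = x := G.d_s_self 0 x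

theorem d_one_s_zero {n : ℕ} (x : G.X n) : G.d 1 (G.s 0 x) = x := G.d_s_succ 0 x

theorem d_zero_twist {n : ℕ} (c : G.X (n + 1)) (γ : G.X n) : G.d 0 (G.twist c γ) = γ := by
  simp [twist, d_zero_s_zero]

theorem d_one_twist {n : ℕ} (c : G.X (n + 1)) (γ : G.X n) :
    G.d 1 (G.twist c γ) = (G.d 1 c)⁻¹ * (G.d 0 c * γ) := by
  simp [twist, d_one_s_zero, mul_assoc]

theorem d_succ_succ_twist {n : ℕ} (l : Fin (n + 1)) (c : G.X (n + 2)) (γ : G.X (n + 1)) :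
    G.d l.succ.succ (G.twist c γ) = G.twist (G.d l.succ.succ c) (G.d l.succ γ) := by
  have h1 (x : G.X (n + 1)) : G.d l.succ.succ (G.s 0 x) = G.s 0 (G.d l.succ x) :=
    G.d_s_of_gt l.succ 0 (Fin.succ_pos l) x
  have h2 : G.d 0 (G.d l.succ.succ c) = G.d l.succ (G.d 0 c) :=
    G.d_d 0 l.succ (Fin.zero_le _) c
  simp [twist, h1, h2]

theorem s_succ_twist {n : ℕ} (k : Fin (n + 1)) (c : G.X (n + 1)) (γ : G.X n) :
    G.s k.succ (G.twist c γ) = G.twist (G.s k.succ c) (G.s k γ) := by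
  have h1 (x : G.X n) : G.s k.succ (G.s 0 x) = G.s 0 (G.s k x) :=
    (G.s_s 0 k (Fin.zero_le _) x).symm
  have h2 : G.d 0 (G.s k.succ c) = G.s k (G.d 0 c) := G.d_s_of_le 0 k (Fin.zero_le _) c
  simp [twist, h1, h2]

theorem twist_s_zero_one {n : ℕ} (c : G.X n) : G.twist (G.s 0 c) 1 = 1 := by
  simp [twist, d_zero_s_zero]

/-! ### The tail of the closed formula and its compatibilities -/

variable (G)

/-- The entries of the twisted degeneracy after the first:
`(c; γⁿ⁻¹; …) ↦ (c⁻¹ · s₀ d₀ c · s₀ γⁿ⁻¹; …)`, continued with `c` replaced by `d₀ c · γⁿ⁻¹`. -/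
noncomputable def twistTail : ∀ n : ℕ, G.X n → G.WbarObj n → G.dec.WbarObj n
  | 0, _, x => x
  | n + 1, c, x => (G.twist c x.1, twistTail n (G.d 0 c * x.1) x.2)

theorem twistTail_smooth : ∀ n : ℕ,
    Mfd.Smooth (M := (G.X n).toMfd.prod (G.WbarObj n)) (N := G.dec.WbarObj n)
      (fun x => G.twistTail n x.1 x.2)
  | 0 => by
    have h : ContMDiff ((G.X 0).I.prod (G.WbarObj 0).I) (G.WbarObj 0).I ∞
        (fun x : G.X 0 × G.WbarObj 0 => x.2) := contMDiff_snd
    exact h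
  | n + 1 => by
    have h1 : ContMDiff ((G.X (n + 1)).I.prod ((G.X n).I.prod (G.WbarObj n).I))
        (G.X (n + 1)).I ∞
        (fun x : G.X (n + 1) × (G.X n × G.WbarObj n) => x.1) := contMDiff_fst
    have h2 : ContMDiff ((G.X (n + 1)).I.prod ((G.X n).I.prod (G.WbarObj n).I))
        ((G.X n).I.prod (G.WbarObj n).I) ∞
        (fun x : G.X (n + 1) × (G.X n × G.WbarObj n) => x.2) := contMDiff_snd
    have h3 := contMDiff_fst.comp h2
    have h4 := (G.smooth_d 0).comp h1
    exact ((h1.inv.mul ((G.smooth_s 0).comp h4)).mul ((G.smooth_s 0).comp h3)).prodMk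
      ((twistTail_smooth n).comp ((h4.mul h3).prodMk (contMDiff_snd.comp h2)))

/-- The accumulated product is compatible with faces because `d₀ d_{l+1} c = d_l d₀ c`. The face
`∂̄₀` is absent: the corresponding face of `W` merges the first entry into the tail and is treated
in `twistedDegeneracy`. -/
theorem twistTail_WbarD : ∀ (n : ℕ) (l : Fin (n + 1)) (c : G.X (n + 1)) (x : G.WbarObj (n + 1)),
    G.twistTail n (G.d l.succ c) (G.WbarD n l.succ x)
      = G.dec.WbarD n l.succ (G.twistTail (n + 1) c x)
  | 0, _, _, _ => rfl
  | n + 1, l, c, x => by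
    obtain ⟨a, b, w⟩ := x
    have h (j : Fin (n + 2)) : G.d 0 (G.d j.succ c) = G.d j (G.d 0 c) :=
      G.d_d 0 j (Fin.zero_le _) c
    induction l using Fin.cases with
    | zero =>
      have h' : G.d 0 (G.d 1 c) = G.d 0 (G.d 0 c) := h 0
      refine Prod.ext ?_ ?_
      -- The zeroth face of `Dec G` is `d₁`, and `d₁` of the first factor is `(d₁ c)⁻¹ · (d₀ c ·
      -- a)`. The bracket cancels the inverse that opens the second factor.
      · change G.twist (G.d 1 c) (G.d 0 a * b)
          = G.d 1 (G.twist c a) * G.twist (G.d 0 c * a) b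
        rw [d_one_twist]
        simp [twist, h', mul_assoc]
      · change G.twistTail n (G.d 0 (G.d 1 c) * (G.d 0 a * b)) w
          = G.twistTail n (G.d 0 (G.d 0 c * a) * b) w
        rw [h', map_mul, mul_assoc]
    | succ l =>
      refine Prod.ext (d_succ_succ_twist l c a).symm ?_
      change G.twistTail n (G.d 0 (G.d l.succ.succ c) * G.d l.succ a) (G.WbarD n l.succ (b, w))
        = G.dec.WbarD n l.succ (G.twistTail (n + 1) (G.d 0 c * a) (b, w))
      rw [h, ← map_mul]
      exact twistTail_WbarD n l _ (b, w)

/-- At the inserted `1` the accumulated product is `s₀ c`. Its twisted entry is trivial, and it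
continues as `d₀ s₀ c · 1 = c`, so the later entries do not change. -/
theorem twistTail_WbarS : ∀ (n : ℕ) (k : Fin (n + 1)) (c : G.X n) (x : G.WbarObj n),
    G.twistTail (n + 1) (G.s k c) (G.WbarS n k x) = G.dec.WbarS n k (G.twistTail n c x)
  | 0, k, c, x => by
    obtain rfl : k = 0 := Fin.fin_one_eq_zero _
    exact Prod.ext (twist_s_zero_one c) rfl
  | n + 1, k, c, x => by
    induction k using Fin.cases with
    | zero =>
      refine Prod.ext (twist_s_zero_one c) ?_
      change G.twistTail (n + 1) (G.d 0 (G.s 0 c) * 1) x = G.twistTail (n + 1) c x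
      rw [mul_one, d_zero_s_zero]
    | succ k =>
      refine Prod.ext (s_succ_twist k c x.1).symm ?_
      change G.twistTail (n + 1) (G.d 0 (G.s k.succ c) * G.s k x.1) (G.WbarS n k x.2)
        = G.dec.WbarS n k (G.twistTail n (G.d 0 c * x.1) x.2)
      have h : G.d 0 (G.s k.succ c) = G.s k (G.d 0 c) := G.d_s_of_le 0 k (Fin.zero_le _) c
      rw [h, ← map_mul, twistTail_WbarS n]

theorem WbarMapApp_decD0_twistTail : ∀ (n : ℕ) (c : G.X n) (x : G.WbarObj n),
    WbarMapApp G.decD0 n (G.twistTail n c x) = x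
  | 0, _, _ => rfl
  | n + 1, c, x =>
    Prod.ext (d_zero_twist c x.1) (WbarMapApp_decD0_twistTail n (G.d 0 c * x.1) x.2)

/-- The twisted degeneracy
`ε_p (γᵖ; …; γ⁰) = (s₀ γᵖ; cₚ⁻¹ · s₀ d₀ cₚ · s₀ γᵖ⁻¹; …; c₁⁻¹ · s₀ d₀ c₁ · s₀ γ⁰)`, where
`cₚ = γᵖ` and `cₖ = d₀ cₖ₊₁ · γᵏ`. -/
noncomputable def twistedDegeneracy : SimplicialMfd.Hom G.W G.dec.W where
  app p w := (G.s 0 w.1, G.twistTail p w.1 w.2)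
  smooth p := by
    have h1 : ContMDiff ((G.X p).I.prod (G.WbarObj p).I) (G.X p).I ∞
        (fun x : G.X p × G.WbarObj p => x.1) := contMDiff_fst
    exact ((G.smooth_s 0).comp h1).prodMk (G.twistTail_smooth p)
  comm_d {p} i w := by
    induction i using Fin.cases with
    | zero =>
      obtain ⟨a, b, w⟩ := w
      -- The tails agree by definition, since `∂₀ w` starts with `d₀ a · b`, the next accumulated
      -- product. In the first entry `d₁ s₀ a = a` cancels the `a⁻¹` of the twist.
      refine Prod.ext ?_ rfl
      change G.s 0 (G.d 0 a * b) = G.d 1 (G.s 0 a) * G.twist a b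
      rw [d_one_s_zero]
      simp [twist, mul_assoc]
    | succ l =>
      exact Prod.ext (G.d_s_of_gt l.succ 0 (Fin.succ_pos l) w.1).symm
        (G.twistTail_WbarD p l w.1 w.2)
  comm_s {p} k w :=
    Prod.ext (G.s_s 0 k (Fin.zero_le _) w.1) (G.twistTail_WbarS p k w.1 w.2)

theorem twistedDegeneracy_isTwistedDegeneracy :
    G.IsTwistedDegeneracy G.twistedDegeneracy.app where
  zero _ := rfl
  one _ _ := rfl
  step p w := by
    refine ⟨G.twist w.1 w.2.1, ⟨?_, d_zero_twist _ _⟩, rfl⟩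
    -- Simpliciality moves `∂₂ ⋯ ∂_p` past `ε`. What remains is the initial vertex, in `Dec G`, of
    -- the second entry of `ε_p (w)`.
    rw [G.twistedDegeneracy.comm_front, W_front_snd_fst]
    exact (G.toSimplicialMfd.dec_initialVertex _ _).symm

/-! ### Uniqueness and the main theorem -/

variable {G}

theorem IsTwistedDegeneracy.unique (hG : G.IsStrictLieTwoGroup)
    {ε ε' : ∀ p : ℕ, G.W.X p → G.dec.W.X p} (h : G.IsTwistedDegeneracy ε)
    (h' : G.IsTwistedDegeneracy ε') : ε = ε' := by
  -- Kept apart from the induction because every step of the recursion refers back to `ε₁` as well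
  -- as to its predecessor.
  have h1 : ε 1 = ε' 1 := funext fun ⟨γ, g, _⟩ => (h.one γ g).trans (h'.one γ g).symm
  funext p
  induction p with
  | zero => exact funext fun ⟨g, _⟩ => (h.zero g).trans (h'.zero g).symm
  | succ p ih =>
    cases p with
    | zero => exact h1
    | succ p =>
      funext w
      obtain ⟨y, ⟨hf, h0⟩, hy⟩ := h.step p w
      obtain ⟨y', ⟨hf', h0'⟩, hy'⟩ := h'.step p w
      obtain rfl : y = y' := hG.ext_front _ _ _
        (hf.trans ((congrArg (fun e => (e (G.W.front (p + 1) w)).2.1) h1).trans hf'.symm))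
        (h0.trans h0'.symm)
      rw [hy, hy', ih]

end SimplicialLieGrp

theorem mainTheorem5 (G : SimplicialLieGrp.{u}) (hG : G.IsStrictLieTwoGroup) :
    ∃ ε : SimplicialMfd.Hom G.W G.dec.W,
      G.IsTwistedDegeneracy ε.app ∧
      (∀ ε' : ∀ p : ℕ, G.W.X p → G.dec.W.X p, G.IsTwistedDegeneracy ε' → ε' = ε.app) ∧
      ∀ (p : ℕ) (w : G.W.X p),
        (SimplicialLieGrp.WMap G.decD0).app p (ε.app p w) = w :=
  ⟨G.twistedDegeneracy, G.twistedDegeneracy_isTwistedDegeneracy,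
    fun _ h => h.unique hG G.twistedDegeneracy_isTwistedDegeneracy,
    fun p w => Prod.ext (SimplicialLieGrp.d_zero_s_zero w.1)
      (G.WbarMapApp_decD0_twistTail p w.1 w.2)⟩
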